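/- Let $\mathbb K$ be $\mathbb R$ or $\mathbb C$ and let $T$ be a Hausdorff space. A Banach bundle $\xi=(\mathcal E,p,T)$ consists of a topological space $\mathcal E$ and a continuous open surjection $p:\mathcal E\to T$ whose fibers $\mathcal E(t)=p^{-1}(t)$ are Banach spaces over $\mathbb K$, such that addition $\{(x,y)\in\mathcal E\times\mathcal E : p(x)=p(y)\}\to\mathcal E$ and scalar multiplication $\mathbb K\times\mathcal E\to\mathcal E$ are continuous, the norm $x\mapsto\|x\|$ is upper semi-continuous on $\mathcal E$, and for every $t\in T$ each neighborhood of the origin $0_t$ of $\mathcal E(t)$ contains a set $\{x\in\mathcal E : p(x)\in V,\ \|x\|<\varepsilon\}$ with $V$ a neighborhood of $t$ and $\varepsilon>0$. The bundle is called continuous if $x\mapsto\|x\|$ is continuous on $\mathcal E$. A Banach bundle map from $(\mathcal E_1,p_1,T)$ to $(\mathcal E_2,p_2,T)$ is a continuous map $\varphi:\mathcal E_1\to\mathcal E_2$ with $p_2\circ\varphi=p_1$ whose restriction to each fiber is linear. Paracompact spaces are Hausdorff by convention. Let $\xi_1=(\mathcal E_1,p_1,T)$ and $\xi_2=(\mathcal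 E_2,p_2,T)$ be Banach bundles with $\mathcal E_2$ paracompact, and let $\varphi$ be a Banach bundle map from $\xi_1$ to $\xi_2$ with $\varphi(\mathcal E_1)=\mathcal E_2$. (1) If $\varphi$ is open, then there exists a continuous map $\psi:\mathcal E_2\to\mathcal E_1$ such that $\varphi(\psi(y))=y$ for every $y\in\mathcal E_2$. (2) If $\xi_2$ is a continuous Banach bundle and there exists $m>0$ such that for every $y\in\mathcal E_2$ there is $x\in\mathcal E_1$ with $\varphi(x)=y$ and $\|x\|\le m\|y\|$, then there exists a continuous map $\psi:\mathcal E_2\to\mathcal E_1$ such that $\varphi(\psi(y))=y$ and $\psi(\lambda y)=\lambda\psi(y)$ for every $y\in\mathcal E_2$ and $\lambda\in\mathbb K$. -/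

import Mathlib

open Topology

namespace BanachBundle

universe u v w

/-- The bundle space: the disjoint union of the fibers `E t`, `t : T`, with projection
`x ↦ x.proj`; the element of the fiber is `x.snd`. Its topology is a separate datum. -/
abbrev Tot {T : Type u} (E : T → Type v) : Type (max u v) := Bundle.TotalSpace Unit E

/-- Multiplication by a scalar in the fibers. -/
def scale {𝕜 : Type w} {T : Type u} {E : T → Type v} [∀ t, SMul 𝕜 (E t)]
    (c : 𝕜) (x : Tot E) : Tot E := ⟨x.proj, c • x.snd⟩

/-- The fiber product `{(x, y) | p x = p y}` inside `Tot E × Tot E`, written as the set of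
triples `(t, x, y)` with `x y : E t`. -/
abbrev FiberProd {T : Type u} (E : T → Type v) : Type (max u v) :=
  Bundle.TotalSpace (Unit × Unit) (fun t => E t × E t)

/-- The inclusion of the fiber product in `Tot E × Tot E`. -/
def FiberProd.incl {T : Type u} {E : T → Type v} (q : FiberProd E) : Tot E × Tot E :=
  (⟨q.proj, q.snd.1⟩, ⟨q.proj, q.snd.2⟩)

/-- Addition in the fibers. -/
def FiberProd.add {T : Type u} {E : T → Type v} [∀ t, Add (E t)] (q : FiberProd E) : Tot E :=
  ⟨q.proj, q.snd.1 + q.snd.2⟩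

/-- A family of Banach spaces `E t`, `t : T`, and a topology on the disjoint union of the fibers
form a Banach bundle over `T` (with upper semi-continuous norm). Surjectivity of the projection
is automatic, as every fiber contains `0`. -/
class IsBanachBundle (𝕜 : Type w) [RCLike 𝕜] {T : Type u} [TopologicalSpace T] (E : T → Type v)
    [∀ t, NormedAddCommGroup (E t)] [∀ t, NormedSpace 𝕜 (E t)] [TopologicalSpace (Tot E)] :
    Prop where
  complete_fiber : ∀ t, CompleteSpace (E t)
  continuous_proj : Continuous (fun x : Tot E => x.proj)
  isOpenMap_proj : IsOpenMap (fun x : Tot E => x.proj)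
  /-- addition is continuous for the topology induced on the fiber product by `Tot E × Tot E` -/
  continuous_add : Continuous[TopologicalSpace.induced FiberProd.incl inferInstance, _]
    (FiberProd.add : FiberProd E → Tot E)
  continuous_smul : Continuous (fun q : 𝕜 × Tot E => scale q.1 q.2)
  upperSemicontinuous_norm : UpperSemicontinuous (fun x : Tot E => ‖x.snd‖)
  /-- the sets `{x | p x ∈ V, ‖x‖ < ε}`, `V` a neighborhood of `t`, are small near `0_t` -/
  nhds_zero : ∀ (t : T), ∀ U ∈ 𝓝 (⟨t, 0⟩ : Tot E), ∃ V ∈ 𝓝 t, ∃ ε : ℝ, 0 < ε ∧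
    ∀ x : Tot E, x.proj ∈ V → ‖x.snd‖ < ε → x ∈ U

/-- The norm is continuous on the bundle space. -/
def HasContinuousNorm {T : Type u} (E : T → Type v) [∀ t, NormedAddCommGroup (E t)]
    [TopologicalSpace (Tot E)] : Prop :=
  Continuous (fun x : Tot E => ‖x.snd‖)

/-- A map of the bundle spaces is a Banach bundle map if it is continuous, maps the fiber over
each `t` into the fiber over `t`, and is linear on each fiber. -/
structure IsBundleMap (𝕜 : Type w) [RCLike 𝕜] {T : Type u} {E₁ : T → Type*} {E₂ : T → Type*}
    [∀ t, NormedAddCommGroup (E₁ t)] [∀ t, NormedSpace 𝕜 (E₁ t)] [TopologicalSpace (Tot E₁)]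
    [∀ t, NormedAddCommGroup (E₂ t)] [∀ t, NormedSpace 𝕜 (E₂ t)] [TopologicalSpace (Tot E₂)]
    (φ : Tot E₁ → Tot E₂) : Prop where
  continuous : Continuous φ
  linear_fiber : ∀ t : T, ∃ L : E₁ t →ₗ[𝕜] E₂ t, ∀ x : E₁ t, φ ⟨t, x⟩ = ⟨t, L x⟩

end BanachBundle

/-! A right inverse of `φ` is a continuous selection of the sets `φ⁻¹(y)`, which are closed convex
subsets of the fibers of `E₁`. Openness of `φ` says exactly that these sets depend lower
semicontinuously on `y`, so (1) is Michael's selection theorem over the paracompact space `Tot E₂`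
(`exists_continuous_selection`). Norms compare points of one fiber only; thin neighborhoods
(`exists_thin_nhds`) replace balls when the fiber varies.

In (2) the bound on preimages makes `φ` open (`isOpenMap_of_bound`). Selecting from `φ⁻¹(y)` cut by
a ball of radius `m‖y‖ + 1` gives a right inverse `f` bounded on unit vectors. The Haar average of
`s⁻¹ f(s y)` over scalars with `|s| = 1` commutes with such scalars, and its radial extension is
homogeneous (`exists_homogeneous_rightInverse`). Continuity at zero vectors comes from the bound. -/

namespace BanachBundle

/-! ### Topology of a Banach bundle near a point -/

section Basic

variable (𝕜 : Type*) [RCLike 𝕜] {T : Type*} [TopologicalSpace T] {E : T → Type*}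
  [∀ t, NormedAddCommGroup (E t)] [∀ t, NormedSpace 𝕜 (E t)] [TopologicalSpace (Tot E)]
  [IsBanachBundle 𝕜 E]

include 𝕜

theorem exists_nhds_add {t : T} {a b : E t} {W : Set (Tot E)} (hW : W ∈ 𝓝 (⟨t, a + b⟩ : Tot E)) :
    ∃ U ∈ 𝓝 (⟨t, a⟩ : Tot E), ∃ V ∈ 𝓝 (⟨t, b⟩ : Tot E), ∀ (s : T) (x y : E s),
      (⟨s, x⟩ : Tot E) ∈ U → (⟨s, y⟩ : Tot E) ∈ V → (⟨s, x + y⟩ : Tot E) ∈ W := by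
  let _ : TopologicalSpace (FiberProd E) := TopologicalSpace.induced FiberProd.incl inferInstance
  have h := (IsBanachBundle.continuous_add 𝕜 (E := E)).continuousAt (x := ⟨t, (a, b)⟩)
  have h2 := h hW
  rw [Filter.mem_map, nhds_induced, Filter.mem_comap] at h2
  obtain ⟨S, hS, hSW⟩ := h2
  rw [FiberProd.incl, nhds_prod_eq, Filter.mem_prod_iff] at hS
  obtain ⟨U, hU, V, hV, hUV⟩ := hS
  refine ⟨U, hU, V, hV, fun s x y hx hy => ?_⟩
  have : (⟨s, (x, y)⟩ : FiberProd E) ∈ FiberProd.incl ⁻¹' S := hUV ⟨hx, hy⟩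
  exact hSW this

theorem continuous_proj : Continuous (fun x : Tot E => x.proj) :=
  IsBanachBundle.continuous_proj 𝕜

variable {X : Type*} [TopologicalSpace X] {q : X → T} {x₀ : X}

theorem continuousAt_add {f g : ∀ x, E (q x)}
    (hf : ContinuousAt (fun x => (⟨q x, f x⟩ : Tot E)) x₀)
    (hg : ContinuousAt (fun x => (⟨q x, g x⟩ : Tot E)) x₀) :
    ContinuousAt (fun x => (⟨q x, f x + g x⟩ : Tot E)) x₀ := by
  intro W hW
  obtain ⟨U, hU, V, hV, h⟩ := exists_nhds_add 𝕜 hW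
  rw [Filter.mem_map]
  filter_upwards [hf hU, hg hV] with x hx hy using h _ _ _ hx hy

theorem continuousAt_smul {c : X → 𝕜} {f : ∀ x, E (q x)} (hc : ContinuousAt c x₀)
    (hf : ContinuousAt (fun x => (⟨q x, f x⟩ : Tot E)) x₀) :
    ContinuousAt (fun x => (⟨q x, c x • f x⟩ : Tot E)) x₀ :=
  (IsBanachBundle.continuous_smul (𝕜 := 𝕜) (E := E)).continuousAt.comp (f := fun x =>
    ((c x, ⟨q x, f x⟩) : 𝕜 × Tot E)) (hc.prodMk hf)

theorem nhds_zero_mem {t : T} {ε : ℝ} (hε : 0 < ε) :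
    {x : Tot E | ‖x.snd‖ < ε} ∈ 𝓝 (⟨t, 0⟩ : Tot E) :=
  IsBanachBundle.upperSemicontinuous_norm (𝕜 := 𝕜) (E := E) ⟨t, 0⟩ ε (by simpa using hε)

theorem continuousAt_zero (hq : ContinuousAt q x₀) :
    ContinuousAt (fun x => (⟨q x, 0⟩ : Tot E)) x₀ := by
  intro W hW
  obtain ⟨V, hV, ε, hε, h⟩ := IsBanachBundle.nhds_zero 𝕜 _ W hW
  rw [Filter.mem_map]
  filter_upwards [hq hV] with x hx using h _ hx (by simpa using hε)

theorem continuousAt_sum {ι : Type*} (s : Finset ι) (c : ι → 𝕜) {f : ι → ∀ x, E (q x)}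
    (hq : ContinuousAt q x₀)
    (hf : ∀ i ∈ s, ContinuousAt (fun x => (⟨q x, f i x⟩ : Tot E)) x₀) :
    ContinuousAt (fun x => (⟨q x, ∑ i ∈ s, c i • f i x⟩ : Tot E)) x₀ := by
  classical
  induction s using Finset.induction_on with
  | empty => simpa using continuousAt_zero 𝕜 hq
  | insert i s hi ih =>
    simp only [Finset.sum_insert hi]
    exact continuousAt_add 𝕜
      (continuousAt_smul 𝕜 continuousAt_const (hf i (Finset.mem_insert_self _ _)))
      (ih fun j hj => hf j (Finset.mem_insert_of_mem hj))

/-- Every point of the bundle space has a neighborhood whose fibers have small diameter. -/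
theorem exists_thin_nhds (x : Tot E) {ε : ℝ} (hε : 0 < ε) :
    ∃ U : Set (Tot E), IsOpen U ∧ x ∈ U ∧ ∀ (s : T) (a b : E s),
      (⟨s, a⟩ : Tot E) ∈ U → (⟨s, b⟩ : Tot E) ∈ U → ‖a - b‖ < ε := by
  obtain ⟨t, a⟩ := x
  -- Continuity of `(x, y) ↦ x + (-1) • y` at `(a, a)`, where its value is `0`.
  have h0 : {x : Tot E | ‖x.snd‖ < ε} ∈ 𝓝 (⟨t, a + (-1 : 𝕜) • a⟩ : Tot E) := by
    have : a + (-1 : 𝕜) • a = 0 := by simp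
    rw [this]
    exact nhds_zero_mem 𝕜 hε
  obtain ⟨U, hU, V, hV, h⟩ := exists_nhds_add 𝕜 h0
  have hV' : {x : Tot E | scale (-1 : 𝕜) x ∈ V} ∈ 𝓝 (⟨t, a⟩ : Tot E) := by
    have hc : Continuous (fun x : Tot E => scale (-1 : 𝕜) x) :=
      (IsBanachBundle.continuous_smul (𝕜 := 𝕜) (E := E)).comp
        (continuous_const.prodMk continuous_id)
    exact hc.continuousAt (x := (⟨t, a⟩ : Tot E)) hV
  obtain ⟨O, hO, hOo, haO⟩ := mem_nhds_iff.1 (Filter.inter_mem hU hV')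
  refine ⟨O, hOo, haO, fun s b c hb hc => ?_⟩
  have := h s b ((-1 : 𝕜) • c) (hO hb).1 (hO hc).2
  simpa [sub_eq_add_neg] using this

/-- Points close in norm to points close to `⟨t, a⟩` are close to `⟨t, a⟩`. -/
theorem exists_nhds_add_small {t : T} {a : E t} {W : Set (Tot E)}
    (hW : W ∈ 𝓝 (⟨t, a⟩ : Tot E)) :
    ∃ U ∈ 𝓝 (⟨t, a⟩ : Tot E), ∃ V ∈ 𝓝 t, ∃ ε : ℝ, 0 < ε ∧ ∀ s ∈ V, ∀ x y : E s,
      (⟨s, x⟩ : Tot E) ∈ U → ‖y - x‖ < ε → (⟨s, y⟩ : Tot E) ∈ W := by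
  have hW' : W ∈ 𝓝 (⟨t, a + 0⟩ : Tot E) := by simpa using hW
  obtain ⟨U, hU, V, hV, h⟩ := exists_nhds_add 𝕜 hW'
  obtain ⟨V', hV', ε, hε, h'⟩ := IsBanachBundle.nhds_zero 𝕜 _ V hV
  refine ⟨U, hU, V', hV', ε, hε, fun s hs x y hx hy => ?_⟩
  simpa using h s x (y - x) hx (h' ⟨s, y - x⟩ hs hy)

theorem continuous_mk_fiber (t : T) : Continuous (fun a : E t => (⟨t, a⟩ : Tot E)) := by
  refine continuous_iff_continuousAt.2 fun a W hW => ?_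
  obtain ⟨U, hU, V, hV, ε, hε, h⟩ := exists_nhds_add_small 𝕜 hW
  rw [Filter.mem_map]
  filter_upwards [Metric.ball_mem_nhds a hε] with b hb
  exact h t (mem_of_mem_nhds hV) a b (mem_of_mem_nhds hU) (by simpa [dist_eq_norm] using hb)

/-- With `continuous_mk_fiber`, this identifies the norm topology of a fiber with the one induced
from the bundle space. -/
theorem continuous_fiber {Y : Type*} [TopologicalSpace Y] {t : T} {f : Y → E t}
    (hf : Continuous fun y => (⟨t, f y⟩ : Tot E)) : Continuous f := by
  refine continuous_iff_continuousAt.2 fun y => Metric.tendsto_nhds.2 fun ε hε => ?_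
  obtain ⟨U, hUo, hyU, hU⟩ := exists_thin_nhds 𝕜 (⟨t, f y⟩ : Tot E) hε
  filter_upwards [hf.continuousAt (hUo.mem_nhds hyU)] with z hz
  rw [dist_eq_norm]
  exact hU t _ _ hz hyU

/-- A lift which is locally a uniform limit of continuous lifts is continuous. -/
theorem continuousAt_of_approx (hq : ContinuousAt q x₀) {f : ∀ x, E (q x)}
    (h : ∀ ε : ℝ, 0 < ε → ∃ g : ∀ x, E (q x), ContinuousAt (fun x => (⟨q x, g x⟩ : Tot E)) x₀ ∧
      ∀ᶠ x in 𝓝 x₀, ‖f x - g x‖ < ε) :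
    ContinuousAt (fun x => (⟨q x, f x⟩ : Tot E)) x₀ := by
  intro W hW
  obtain ⟨U, hU, V, hV, ε, hε, hUV⟩ := exists_nhds_add_small 𝕜 hW
  -- `δ` guarantees that `U` is a neighborhood of `g x₀` too, not only of `f x₀`.
  obtain ⟨U', hU', V', hV', δ, hδ, hUV'⟩ :=
    exists_nhds_add_small 𝕜 (eventually_mem_nhds_iff.2 hU)
  obtain ⟨g, hg, hfg⟩ := h (min ε δ) (lt_min hε hδ)
  have h1 : U ∈ 𝓝 (⟨q x₀, g x₀⟩ : Tot E) := by
    refine hUV' _ (mem_of_mem_nhds hV') (f x₀) (g x₀) (mem_of_mem_nhds hU') ?_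
    rw [norm_sub_rev]
    exact hfg.self_of_nhds.trans_le (min_le_right _ _)
  rw [Filter.mem_map]
  filter_upwards [hg h1, hfg, hq hV] with x hx hx' hxV
  exact hUV _ hxV _ _ hx (hx'.trans_le (min_le_left _ _))

end Basic

/-! ### Michael's selection theorem -/

section Selection

variable {T : Type*} [TopologicalSpace T] {E : T → Type*}
  [∀ t, NormedAddCommGroup (E t)] [∀ t, NormedSpace ℝ (E t)] [TopologicalSpace (Tot E)]
  {X : Type*} [TopologicalSpace X] {q : X → T}

/-- A lift `f` of `q` is an `ε`-approximate lift at `x₀` with respect to the sets `C x ⊆ E (q x)`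
if close to `x₀` it is `ε`-close to points of `C x` in a given neighborhood of `f x₀`. -/
def ApproxLiftAt (q : X → T) (C : ∀ x, Set (E (q x))) (ε : ℝ) (f : ∀ x, E (q x)) (x₀ : X) :
    Prop :=
  ∀ W ∈ 𝓝 (⟨q x₀, f x₀⟩ : Tot E), ∀ᶠ x in 𝓝 x₀, ∃ w ∈ C x,
    (⟨q x, w⟩ : Tot E) ∈ W ∧ ‖f x - w‖ < ε

variable [IsBanachBundle ℝ E] {C : ∀ x, Set (E (q x))} {ε : ℝ} {x₀ : X}

/-- The `f i` need not be continuous, so continuity of the operations is applied to the nearby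
points `w i` instead. Keeping each `w i` in `C x` and `ε`-close to `f i x` lets a convex combination
inherit both properties. -/
theorem eventually_exists_sum_mem {ι : Type*} (s : Finset ι) {c : ι → X → ℝ}
    {f : ι → ∀ x, E (q x)} (hq : ContinuousAt q x₀) (hc : ∀ i, Continuous (c i))
    (hf : ∀ i ∈ s, ApproxLiftAt q C ε (f i) x₀) :
    ∀ W ∈ 𝓝 (⟨q x₀, ∑ i ∈ s, c i x₀ • f i x₀⟩ : Tot E), ∀ᶠ x in 𝓝 x₀, ∃ w : ι → E (q x),
      (∀ i ∈ s, w i ∈ C x ∧ ‖f i x - w i‖ < ε) ∧ (⟨q x, ∑ i ∈ s, c i x • w i⟩ : Tot E) ∈ W := by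
  classical
  induction s using Finset.induction_on with
  | empty =>
    intro W hW
    simp only [Finset.sum_empty] at hW ⊢
    filter_upwards [continuousAt_zero ℝ hq hW] with x hx using ⟨fun _ => 0, by simp, hx⟩
  | insert i s hi ih =>
    intro W hW
    simp only [Finset.sum_insert hi] at hW ⊢
    obtain ⟨U, hU, V, hV, hUV⟩ := exists_nhds_add ℝ hW
    have h1 := (IsBanachBundle.continuous_smul (𝕜 := ℝ) (E := E)).continuousAt
      (x := (c i x₀, ⟨q x₀, f i x₀⟩)) hU
    rw [Filter.mem_map, nhds_prod_eq, Filter.mem_prod_iff] at h1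
    obtain ⟨N, hN, U', hU', hNU⟩ := h1
    filter_upwards [(hc i).continuousAt hN, hf i (Finset.mem_insert_self _ _) U' hU',
      ih (fun j hj => hf j (Finset.mem_insert_of_mem hj)) V hV] with x hxN hxi hxs
    obtain ⟨w, hwC, hwU, hwε⟩ := hxi
    obtain ⟨w', hw', hwV⟩ := hxs
    have hne : ∀ j ∈ s, j ≠ i := fun j hj h => hi (h ▸ hj)
    refine ⟨Function.update w' i w, fun j hj => ?_, ?_⟩
    · rcases Finset.mem_insert.1 hj with rfl | hj
      · simpa using ⟨hwC, hwε⟩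
      · simpa [hne j hj] using hw' j hj
    · rw [Function.update_self, Finset.sum_congr rfl fun j hj => by
        rw [Function.update_of_ne (hne j hj)]]
      exact hUV _ _ _ (hNU (Set.mk_mem_prod (a := c i x) (b := (⟨q x, w⟩ : Tot E)) hxN hwU)) hwV

/-- Approximate selections can be glued by means of a partition of unity. -/
theorem exists_approx_selection [T2Space X] [ParacompactSpace X] (hq : Continuous q)
    (hconv : ∀ x, Convex ℝ (C x))
    (hlsc : ∀ W : Set (Tot E), IsOpen W → IsOpen {x | ∃ w ∈ C x, (⟨q x, w⟩ : Tot E) ∈ W})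
    {D : ∀ x, Set (E (q x))} (hDC : ∀ x, D x ⊆ C x) (hD : ∀ x, Convex ℝ (D x))
    (hDlsc : ∀ x₀, ∃ w₀ : E (q x₀), ∀ W ∈ 𝓝 (⟨q x₀, w₀⟩ : Tot E), ∀ᶠ x in 𝓝 x₀, ∃ w ∈ D x,
      (⟨q x, w⟩ : Tot E) ∈ W) (hε : 0 < ε) :
    ∃ f : ∀ x, E (q x), (∀ x, f x ∈ D x) ∧ ∀ x, ApproxLiftAt q C ε f x := by
  classical
  have hloc : ∀ x₀, ∃ O : Set X, IsOpen O ∧ x₀ ∈ O ∧ ∃ g : ∀ x, E (q x),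
      (∀ x ∈ O, g x ∈ D x) ∧ ∀ x ∈ O, ApproxLiftAt q C ε g x := by
    intro x₀
    obtain ⟨w₀, hw₀⟩ := hDlsc x₀
    obtain ⟨U, hUo, hwU, hU⟩ := exists_thin_nhds ℝ (⟨q x₀, w₀⟩ : Tot E) hε
    obtain ⟨O, hO, hOo, hxO⟩ := eventually_nhds_iff.1 (hw₀ U (hUo.mem_nhds hwU))
    choose! g hgD hgU using hO
    refine ⟨O, hOo, hxO, g, hgD, fun x hx W hW => ?_⟩
    obtain ⟨W', hW', hW'o, hxW'⟩ := mem_nhds_iff.1 hW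
    -- `g` is an arbitrary choice. Its values lie in the thin set `U`, so asking for `w` in `U` as
    -- well yields `‖g y - w‖ < ε`.
    have hmem : x ∈ {x | ∃ w ∈ C x, (⟨q x, w⟩ : Tot E) ∈ W' ∩ U} :=
      ⟨g x, hDC x (hgD x hx), hxW', hgU x hx⟩
    filter_upwards [(hlsc _ (hW'o.inter hUo)).mem_nhds hmem, hOo.mem_nhds hx] with y hy hyO
    obtain ⟨w, hwC, hwW, hwU⟩ := hy
    exact ⟨w, hwC, hW' hwW, hU _ _ _ (hgU y hyO) hwU⟩
  choose O hOo hxO g hgD hgA using hloc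
  obtain ⟨ρ, hρ⟩ := PartitionOfUnity.exists_isSubordinate isClosed_univ O hOo
    fun x _ => Set.mem_iUnion.2 ⟨x, hxO x⟩
  have hsupp : ∀ i x, ρ i x ≠ 0 → x ∈ O i := fun i x h =>
    hρ i (subset_tsupport _ (Function.mem_support.2 h))
  have hev : ∀ x₀, ∀ᶠ x in 𝓝 x₀, ∑ i ∈ ρ.fintsupport x₀, ρ i x = 1 ∧
      ∑ᶠ i, ρ i x • g i x = ∑ i ∈ ρ.fintsupport x₀, ρ i x • g i x := by
    intro x₀
    filter_upwards [ρ.eventually_finsupport_subset x₀] with x hx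
    constructor
    · rw [← ρ.sum_eq_one (Set.mem_univ x)]
      refine (finsum_eq_sum_of_support_subset _ fun i hi => ?_).symm
      exact hx ((ρ.mem_finsupport x).2 hi)
    · refine finsum_eq_sum_of_support_subset _ fun i hi => ?_
      refine hx ((ρ.mem_finsupport x).2 fun h => hi ?_)
      simp [h]
  refine ⟨fun x => ∑ᶠ i, ρ i x • g i x, fun x => ?_, fun x₀ W hW => ?_⟩
  · exact (hD x).finsum_mem (fun i => ρ.nonneg i x) (ρ.sum_eq_one (Set.mem_univ x))
      fun i hi => hgD i x (hsupp i x hi)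
  · have hW' : W ∈ 𝓝 (⟨q x₀, ∑ i ∈ ρ.fintsupport x₀, ρ i x₀ • g i x₀⟩ : Tot E) := by
      rw [← (hev x₀).self_of_nhds.2]
      exact hW
    filter_upwards [hev x₀, eventually_exists_sum_mem (C := C) (ε := ε) (ρ.fintsupport x₀)
      hq.continuousAt (fun i => (ρ i).continuous)
      (fun i hi => hgA i x₀ (hρ i ((ρ.mem_fintsupport_iff x₀ i).1 hi))) W hW'] with x hx hx'
    obtain ⟨w, hw, hwW⟩ := hx'
    refine ⟨_, (hconv x).sum_mem (fun i _ => ρ.nonneg i x) hx.1 fun i hi => (hw i hi).1, hwW, ?_⟩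
    rw [hx.2, ← Finset.sum_sub_distrib]
    simp only [← smul_sub]
    rw [← mem_ball_zero_iff]
    exact (convex_ball (0 : E (q x)) ε).sum_mem (fun i _ => ρ.nonneg i x) hx.1
      fun i hi => mem_ball_zero_iff.2 (hw i hi).2

/-- **Michael's selection theorem** for Banach bundles. -/
theorem exists_continuous_selection [T2Space X] [ParacompactSpace X] (hq : Continuous q)
    (hconv : ∀ x, Convex ℝ (C x)) (hne : ∀ x, (C x).Nonempty)
    (hlsc : ∀ W : Set (Tot E), IsOpen W → IsOpen {x | ∃ w ∈ C x, (⟨q x, w⟩ : Tot E) ∈ W}) :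
    ∃ f : ∀ x, E (q x), Continuous (fun x => (⟨q x, f x⟩ : Tot E)) ∧
      ∀ x, f x ∈ closure (C x) := by
  have hpos : ∀ n : ℕ, (0 : ℝ) < (1 / 2) ^ n := fun n => by positivity
  let A : ℕ → Type _ := fun n => {f : ∀ x, E (q x) // (∀ x, f x ∈ C x) ∧
    ∀ x, ApproxLiftAt q C ((1 / 2) ^ n) f x}
  have hA0 : Nonempty (A 0) := by
    have hl : ∀ x₀, ∃ w₀ : E (q x₀), ∀ W ∈ 𝓝 (⟨q x₀, w₀⟩ : Tot E), ∀ᶠ x in 𝓝 x₀, ∃ w ∈ C x,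
        (⟨q x, w⟩ : Tot E) ∈ W := by
      intro x₀
      obtain ⟨w, hw⟩ := hne x₀
      refine ⟨w, fun W hW => ?_⟩
      obtain ⟨W', hW', hW'o, hxW'⟩ := mem_nhds_iff.1 hW
      filter_upwards [(hlsc _ hW'o).mem_nhds ⟨w, hw, hxW'⟩] with x hx
      obtain ⟨w, h1, h2⟩ := hx
      exact ⟨w, h1, hW' h2⟩
    obtain ⟨f, h1, h2⟩ := exists_approx_selection hq hconv hlsc (fun _ => subset_rfl)
      hconv hl (hpos 0)
    exact ⟨⟨f, h1, h2⟩⟩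
  have hstep : ∀ n (f : A n), ∃ g : A (n + 1), ∀ x, ‖f.1 x - g.1 x‖ < (1 / 2) ^ n := by
    intro n f
    -- As `f` may be discontinuous, these intersections need not be lower semicontinuous; the single
    -- point `f x₀` suffices, by the approximate lift property.
    have hl : ∀ x₀, ∃ w₀ : E (q x₀), ∀ W ∈ 𝓝 (⟨q x₀, w₀⟩ : Tot E), ∀ᶠ x in 𝓝 x₀,
        ∃ w ∈ C x ∩ Metric.ball (f.1 x) ((1 / 2) ^ n), (⟨q x, w⟩ : Tot E) ∈ W := by
      refine fun x₀ => ⟨f.1 x₀, fun W hW => ?_⟩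
      filter_upwards [f.2.2 x₀ W hW] with x hx
      obtain ⟨w, hwC, hwW, hwf⟩ := hx
      exact ⟨w, ⟨hwC, by rwa [Metric.mem_ball, dist_comm, dist_eq_norm]⟩, hwW⟩
    obtain ⟨g, h1, h2⟩ := exists_approx_selection hq hconv hlsc (fun _ => Set.inter_subset_left)
      (fun x => (hconv x).inter (convex_ball _ _)) hl (hpos (n + 1))
    refine ⟨⟨g, fun x => (h1 x).1, h2⟩, fun x => ?_⟩
    have := (h1 x).2
    rwa [Metric.mem_ball, dist_comm, dist_eq_norm] at this
  choose S hS using hstep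
  let F : ∀ n, A n := fun n => Nat.rec hA0.some (fun n f => S n f) n
  have hF : ∀ n x, dist ((F n).1 x) ((F (n + 1)).1 x) ≤ 2 / 2 / 2 ^ n := fun n x => by
    rw [dist_eq_norm]
    refine (hS n (F n) x).le.trans (by simp)
  have hlim : ∀ x, ∃ a, Filter.Tendsto (fun n => (F n).1 x) Filter.atTop (𝓝 a) := fun x =>
    have := IsBanachBundle.complete_fiber (𝕜 := ℝ) (E := E) (q x)
    cauchySeq_tendsto_of_complete (cauchySeq_of_le_geometric_two fun n => hF n x)
  choose f hf using hlim
  have hdist : ∀ n x, ‖f x - (F n).1 x‖ ≤ 2 / 2 ^ n := fun n x => by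
    rw [norm_sub_rev, ← dist_eq_norm]
    exact dist_le_of_le_geometric_two_of_tendsto (fun n => hF n x) (hf x) n
  refine ⟨f, continuous_iff_continuousAt.2 fun x₀ W hW => ?_, fun x =>
    mem_closure_of_tendsto (hf x) (Filter.Eventually.of_forall fun n => (F n).2.1 x)⟩
  obtain ⟨U, hU, V, hV, ε, hε, hUV⟩ := exists_nhds_add_small ℝ hW
  have h1 := ((continuous_mk_fiber ℝ (q x₀)).continuousAt.tendsto.comp (hf x₀)).eventually
    (eventually_mem_nhds_iff.2 hU)
  -- Two units bound the distance from the limit to `F n`, the third that from `F n` to a point `w`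
  -- of `U`.
  have h2 : ∀ᶠ n : ℕ in Filter.atTop, 3 * (1 / 2 : ℝ) ^ n < ε := by
    have := (tendsto_pow_atTop_nhds_zero_of_lt_one (r := (1 / 2 : ℝ)) (by norm_num)
      (by norm_num)).const_mul 3
    rw [mul_zero] at this
    exact this.eventually (gt_mem_nhds hε)
  obtain ⟨n, hn1, hn2⟩ := (h1.and h2).exists
  rw [Filter.mem_map]
  filter_upwards [(F n).2.2 x₀ U hn1, hq.continuousAt hV] with x hx hxV
  obtain ⟨w, -, hwU, hw⟩ := hx
  refine hUV _ hxV w (f x) hwU ?_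
  have h3 := norm_sub_le_norm_sub_add_norm_sub (f x) ((F n).1 x) w
  have h4 := hdist n x
  have h5 : (2 : ℝ) / 2 ^ n = 2 * (1 / 2) ^ n := by simp [div_eq_mul_inv]
  linarith

end Selection

/-- Selection and averaging rest on real convexity and real integrals. -/
theorem IsBanachBundle.restrictScalars (𝕜 : Type*) [RCLike 𝕜] {T : Type*} [TopologicalSpace T]
    (E : T → Type*) [∀ t, NormedAddCommGroup (E t)] [∀ t, NormedSpace 𝕜 (E t)]
    [∀ t, NormedSpace ℝ (E t)] [∀ t, IsScalarTower ℝ 𝕜 (E t)] [TopologicalSpace (Tot E)]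
    [IsBanachBundle 𝕜 E] : IsBanachBundle ℝ E where
  complete_fiber := IsBanachBundle.complete_fiber 𝕜
  continuous_proj := IsBanachBundle.continuous_proj 𝕜
  isOpenMap_proj := IsBanachBundle.isOpenMap_proj 𝕜
  continuous_add := IsBanachBundle.continuous_add 𝕜
  continuous_smul := by
    have h : (fun p : ℝ × Tot E => scale p.1 p.2) = fun p => scale (p.1 : 𝕜) p.2 := by
      ext1 p
      have : (p.1 : 𝕜) • p.2.snd = p.1 • p.2.snd := by
        rw [RCLike.ofReal_alg, smul_assoc, one_smul]
      rw [scale, scale, this]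
    rw [h]
    exact (IsBanachBundle.continuous_smul (𝕜 := 𝕜) (E := E)).comp
      ((RCLike.continuous_ofReal.comp continuous_fst).prodMk continuous_snd)
  upperSemicontinuous_norm := IsBanachBundle.upperSemicontinuous_norm 𝕜
  nhds_zero := IsBanachBundle.nhds_zero 𝕜

/-! ### Averaging lifts over a compact space -/

section Average

open MeasureTheory

variable {T : Type*} [TopologicalSpace T] {E : T → Type*}
  [∀ t, NormedAddCommGroup (E t)] [∀ t, NormedSpace ℝ (E t)] [TopologicalSpace (Tot E)]
  [IsBanachBundle ℝ E] {X : Type*} [TopologicalSpace X] {q : X → T}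

/-- The average of a continuous family of lifts over a compact space is continuous. -/
theorem continuous_integral {S : Type*} [TopologicalSpace S] [CompactSpace S] [T2Space S]
    [SecondCountableTopology S] [MeasurableSpace S] [BorelSpace S]
    (μ : Measure S) [IsProbabilityMeasure μ] (hq : Continuous q) {F : ∀ x, S → E (q x)}
    (hF : Continuous fun p : X × S => (⟨q p.1, F p.1 p.2⟩ : Tot E)) :
    Continuous fun x => (⟨q x, ∫ s, F x s ∂μ⟩ : Tot E) := by
  have hFx : ∀ x, Continuous (F x) := fun x =>
    continuous_fiber ℝ (hF.comp (continuous_const.prodMk continuous_id))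
  have hint : ∀ {G : Type _} [NormedAddCommGroup G] {f : S → G}, Continuous f →
      Integrable f μ := fun hf =>
    hf.integrable_of_hasCompactSupport (HasCompactSupport.of_compactSpace _)
  refine continuous_iff_continuousAt.2 fun x₀ =>
    continuousAt_of_approx ℝ hq.continuousAt fun ε hε => ?_
  have hloc : ∀ s₀ : S, ∃ N ∈ 𝓝 x₀, ∃ M : Set S, IsOpen M ∧ s₀ ∈ M ∧
      ∀ x ∈ N, ∀ s ∈ M, ‖F x s₀ - F x s‖ < ε / 2 := by
    intro s₀
    obtain ⟨U, hUo, hmU, hU⟩ := exists_thin_nhds ℝ (⟨q x₀, F x₀ s₀⟩ : Tot E) (half_pos hε)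
    have h := hF.continuousAt (x := (x₀, s₀)) (hUo.mem_nhds hmU)
    rw [Filter.mem_map, nhds_prod_eq, Filter.mem_prod_iff] at h
    obtain ⟨N, hN, M, hM, hNM⟩ := h
    obtain ⟨M', hM', hMo, hsM⟩ := mem_nhds_iff.1 hM
    exact ⟨N, hN, M', hMo, hsM, fun x hx s hs => hU _ _ _
      (hNM (Set.mk_mem_prod hx (mem_of_mem_nhds hM))) (hNM (Set.mk_mem_prod hx (hM' hs)))⟩
  choose N hN M hMo hsM hNM using hloc
  obtain ⟨J, hJ⟩ := isCompact_univ.elim_finite_subcover M hMo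
    fun s _ => Set.mem_iUnion.2 ⟨s, hsM s⟩
  obtain ⟨ρ, hρ⟩ := PartitionOfUnity.exists_isSubordinate (ι := J) isClosed_univ
    (fun j => M j) (fun j => hMo j) (fun s hs => by simpa using hJ hs)
  have hρF : ∀ x (j : J), Integrable (fun s => ρ j s • F x j) μ := fun x j =>
    hint ((ρ j).continuous.smul continuous_const)
  -- A Riemann sum: `F x s` is replaced by `∑ ρ j s • F x j`, whose integral has coefficients
  -- independent of `x`.
  refine ⟨fun x => ∑ j : J, (∫ s, ρ j s ∂μ) • F x j, continuousAt_sum ℝ _ _ hq.continuousAt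
    fun j _ => (hF.comp (continuous_id.prodMk continuous_const)).continuousAt, ?_⟩
  filter_upwards [Filter.eventually_all.2 fun j : J => hN j] with x hx
  have hsum : ∑ j : J, (∫ s, ρ j s ∂μ) • F x j = ∫ s, ∑ j : J, ρ j s • F x j ∂μ := by
    have := IsBanachBundle.complete_fiber (𝕜 := ℝ) (E := E) (q x)
    rw [integral_finsetSum _ fun j _ => hρF x j]
    simp only [integral_smul_const]
  rw [hsum, ← integral_sub (hint (hFx x)) (integrable_finsetSum _ fun j _ => hρF x j)]
  refine (norm_integral_le_of_norm_le_const (μ := μ) (C := ε / 2)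
    (Filter.Eventually.of_forall fun s => ?_)).trans_lt (by simpa using hε)
  have hmem := (convex_closedBall (F x s) (ε / 2)).finsum_mem (w := fun j => ρ j s)
    (z := fun j : J => F x j) (fun j => ρ.nonneg j s) (ρ.sum_eq_one (Set.mem_univ s))
    fun j hj => by
      rw [mem_closedBall_iff_norm]
      exact (hNM j x (hx j) s (hρ j (subset_tsupport _ (Function.mem_support.2 hj)))).le
  rw [finsum_eq_sum_of_fintype, mem_closedBall_iff_norm'] at hmem
  exact hmem

end Average

/-! ### Bounded preimages and homogeneous right inverses -/

section Homogeneous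

open MeasureTheory

variable {𝕜 : Type*} [RCLike 𝕜] {T : Type*} [TopologicalSpace T]
  {E₁ : T → Type*} [∀ t, NormedAddCommGroup (E₁ t)] [∀ t, NormedSpace 𝕜 (E₁ t)]
  [TopologicalSpace (Tot E₁)] [IsBanachBundle 𝕜 E₁]
  {E₂ : T → Type*} [∀ t, NormedAddCommGroup (E₂ t)] [∀ t, NormedSpace 𝕜 (E₂ t)]
  [TopologicalSpace (Tot E₂)] [IsBanachBundle 𝕜 E₂]

/-- A bundle map with uniformly bounded preimages is open. -/
theorem isOpenMap_of_bound {φ : Tot E₁ → Tot E₂} (hφ : Continuous φ)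
    (L : ∀ t, E₁ t →ₗ[𝕜] E₂ t) (hL : ∀ t x, φ ⟨t, x⟩ = ⟨t, L t x⟩) {m : ℝ} (hm : 0 < m)
    (hbd : ∀ t (y : E₂ t), ∃ x, L t x = y ∧ ‖x‖ ≤ m * ‖y‖) : IsOpenMap φ := by
  rw [isOpenMap_iff_nhds_le]
  rintro ⟨t, x⟩ W hW
  have hW' : φ ⁻¹' W ∈ 𝓝 (⟨t, x⟩ : Tot E₁) := hW
  obtain ⟨U, hU, V, hV, ε, hε, hUV⟩ := exists_nhds_add_small 𝕜 hW'
  obtain ⟨O, hOo, hyO, hO⟩ := exists_thin_nhds 𝕜 (φ ⟨t, x⟩) (div_pos hε hm)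
  have h1 : U ∩ φ ⁻¹' O ∈ 𝓝 (⟨t, x⟩ : Tot E₁) :=
    Filter.inter_mem hU (hφ.continuousAt (hOo.mem_nhds hyO))
  have h2 := (IsBanachBundle.isOpenMap_proj (𝕜 := 𝕜) (E := E₁)).image_mem_nhds h1
  have hpt : (φ ⟨t, x⟩).proj = t := by rw [hL]
  have hp := (continuous_proj 𝕜 (E := E₂)).continuousAt (x := φ ⟨t, x⟩)
  rw [ContinuousAt, hpt] at hp
  filter_upwards [hp h2, hp hV, hOo.mem_nhds hyO] with y hy hyV hyO
  obtain ⟨s, y⟩ := y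
  obtain ⟨⟨s', x'⟩, ⟨hx'U, hx'O⟩, rfl⟩ := hy
  -- `x'` lies over the right base point but maps only near `y`; the small preimage `z` corrects the
  -- error.
  obtain ⟨z, hz, hzm⟩ := hbd _ (y - L _ x')
  have h3 : ‖y - L _ x'‖ < ε / m := hO _ _ _ hyO (by rw [← hL]; exact hx'O)
  have h4 := hUV _ hyV x' (x' + z) hx'U (by
    rw [add_sub_cancel_left]
    refine hzm.trans_lt ?_
    rwa [lt_div_iff₀' hm] at h3)
  rw [Set.mem_preimage, hL, map_add, hz] at h4
  simpa using h4

/-- Averaging over the unit sphere of the scalars and extending radially turns a bounded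
continuous right inverse into a homogeneous one. -/
theorem exists_homogeneous_rightInverse
    [∀ t, NormedSpace ℝ (E₁ t)] [∀ t, IsScalarTower ℝ 𝕜 (E₁ t)]
    (hE₂ : HasContinuousNorm E₂) (L : ∀ t, E₁ t →L[𝕜] E₂ t) (f : ∀ t, E₂ t → E₁ t)
    (hf : Continuous fun y : Tot E₂ => (⟨y.proj, f y.proj y.snd⟩ : Tot E₁))
    (hLf : ∀ t y, L t (f t y) = y) {K : ℝ} (hK : ∀ t (y : E₂ t), ‖y‖ = 1 → ‖f t y‖ ≤ K) :
    ∃ g : ∀ t, E₂ t → E₁ t, Continuous (fun y : Tot E₂ => (⟨y.proj, g y.proj y.snd⟩ : Tot E₁)) ∧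
      (∀ t y, L t (g t y) = y) ∧ ∀ t (c : 𝕜) y, g t (c • y) = c • g t y := by
  have hB : IsBanachBundle ℝ E₁ := .restrictScalars 𝕜 E₁
  have hcomp : ∀ t, CompleteSpace (E₁ t) := IsBanachBundle.complete_fiber 𝕜
  let S := Metric.sphere (0 : 𝕜) 1
  have : CompactSpace S := isCompact_iff_compactSpace.1 (isCompact_sphere 0 1)
  -- Haar measure normalized to give the whole group mass one.
  let μ : Measure S := Measure.haarMeasure ⊤
  have : IsProbabilityMeasure μ := ⟨Measure.haarMeasure_self⟩
  have hS : ∀ s : S, ‖(s : 𝕜)‖ = 1 := fun s => by simp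
  have hS0 : ∀ s : S, (s : 𝕜) ≠ 0 := fun s => ne_zero_of_norm_ne_zero (by simp [hS s])
  let F : ∀ t, E₂ t → S → E₁ t := fun t y s => (s : 𝕜)⁻¹ • f t ((s : 𝕜) • y)
  let h : ∀ t, E₂ t → E₁ t := fun t y => ∫ s, F t y s ∂μ
  have hF : Continuous fun p : Tot E₂ × S => (⟨p.1.proj, F p.1.proj p.1.snd p.2⟩ : Tot E₁) := by
    have h1 : Continuous fun p : Tot E₂ × S => ((p.2 : 𝕜)⁻¹,
        (⟨p.1.proj, f p.1.proj ((p.2 : 𝕜) • p.1.snd)⟩ : Tot E₁)) :=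
      ((continuous_subtype_val.comp continuous_snd).inv₀ fun p => hS0 p.2).prodMk
        (hf.comp ((IsBanachBundle.continuous_smul (𝕜 := 𝕜) (E := E₂)).comp
          ((continuous_subtype_val.comp continuous_snd).prodMk continuous_fst)))
    exact (IsBanachBundle.continuous_smul (𝕜 := 𝕜) (E := E₁)).comp h1
  have hFc : ∀ t y, Continuous (F t y) := fun t y => continuous_fiber 𝕜
    (hF.comp (continuous_const (y := (⟨t, y⟩ : Tot E₂)).prodMk continuous_id))
  have hh : Continuous fun y : Tot E₂ => (⟨y.proj, h y.proj y.snd⟩ : Tot E₁) :=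
    continuous_integral μ (continuous_proj 𝕜) hF
  have hLh : ∀ t y, L t (h t y) = y := fun t y => by
    let _ : NormedSpace ℝ (E₂ t) := NormedSpace.restrictScalars ℝ 𝕜 (E₂ t)
    have : CompleteSpace (E₂ t) := IsBanachBundle.complete_fiber 𝕜 t
    have hi : Integrable (F t y) μ :=
      (hFc t y).integrable_of_hasCompactSupport (HasCompactSupport.of_compactSpace _)
    rw [← (L t).integral_comp_comm hi]
    simp [F, hLf, hS0]
  -- Invariance of `μ` under the substitution `s ↦ c * s`.
  have hhom : ∀ t (c : S) y, h t ((c : 𝕜) • y) = (c : 𝕜) • h t y := fun t c y => by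
    have h1 : ∀ s, F t ((c : 𝕜) • y) s = (c : 𝕜) • F t y (c * s) := fun s => by
      change (s : 𝕜)⁻¹ • f t ((s : 𝕜) • (c : 𝕜) • y) =
        (c : 𝕜) • ((c : 𝕜) * s)⁻¹ • f t (((c : 𝕜) * s) • y)
      rw [mul_inv, smul_smul (c : 𝕜), mul_inv_cancel_left₀ (hS0 c), smul_smul, mul_comm (c : 𝕜)]
    simp only [h, h1]
    rw [integral_smul, integral_mul_left_eq_self]
  have hhK : ∀ t (y : E₂ t), ‖y‖ = 1 → ‖h t y‖ ≤ K := fun t y hy => by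
    refine (norm_integral_le_of_norm_le_const (μ := μ) (C := K)
      (Filter.Eventually.of_forall fun s => ?_)).trans (by simp)
    rw [norm_smul, norm_inv, hS, inv_one, one_mul]
    exact hK t _ (by rw [norm_smul, hS, hy, one_mul])
  -- At `y = 0` the factor `‖y‖` makes the value `0`, whatever the inverse means.
  let g : ∀ t, E₂ t → E₁ t := fun t y => (‖y‖ : 𝕜) • h t ((‖y‖ : 𝕜)⁻¹ • y)
  have hn : ∀ {t} {y : E₂ t}, y ≠ 0 → (‖y‖ : 𝕜) ≠ 0 := fun hy => by simpa using hy
  have hn1 : ∀ {t} {y : E₂ t}, y ≠ 0 → ‖(‖y‖ : 𝕜)⁻¹ • y‖ = 1 := fun hy => by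
    rw [norm_smul, norm_inv, RCLike.norm_ofReal, abs_norm, inv_mul_cancel₀ (norm_ne_zero_iff.2 hy)]
  have hgK : ∀ t (y : E₂ t), ‖g t y‖ ≤ K * ‖y‖ := fun t y => by
    by_cases hy : y = 0
    · simp [g, hy]
    · rw [norm_smul, RCLike.norm_ofReal, abs_norm, mul_comm]
      exact mul_le_mul_of_nonneg_right (hhK t _ (hn1 hy)) (norm_nonneg y)
  refine ⟨g, continuous_iff_continuousAt.2 fun y₀ => ?_, fun t y => ?_, fun t c y => ?_⟩
  · by_cases hy₀ : y₀.snd = 0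
    · intro W hW
      have hg0 : g y₀.proj y₀.snd = 0 := by simp [g, hy₀]
      change W ∈ 𝓝 (⟨y₀.proj, g y₀.proj y₀.snd⟩ : Tot E₁) at hW
      rw [hg0] at hW
      obtain ⟨V, hV, ε, hε, hVW⟩ := IsBanachBundle.nhds_zero 𝕜 _ W hW
      have hc : ContinuousAt (fun y : Tot E₂ => K * ‖y.snd‖) y₀ :=
        (continuous_const.mul hE₂).continuousAt
      rw [Filter.mem_map]
      filter_upwards [(continuous_proj 𝕜).continuousAt hV,
        hc.tendsto.eventually_lt_const (u := ε) (by simpa [hy₀] using hε)] with y hyV hy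
      exact hVW _ hyV ((hgK _ _).trans_lt hy)
    · have hc : ContinuousAt (fun y : Tot E₂ => (‖y.snd‖ : 𝕜)) y₀ :=
        (RCLike.continuous_ofReal.comp hE₂).continuousAt
      have h1 : ContinuousAt (fun y : Tot E₂ => scale (‖y.snd‖ : 𝕜)⁻¹ y) y₀ :=
        (IsBanachBundle.continuous_smul (𝕜 := 𝕜) (E := E₂)).continuousAt.comp
          (f := fun y : Tot E₂ => ((‖y.snd‖ : 𝕜)⁻¹, y)) ((hc.inv₀ (hn hy₀)).prodMk continuousAt_id)
      exact continuousAt_smul 𝕜 (q := fun y : Tot E₂ => y.proj) hc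
        (hh.continuousAt.comp (f := fun y : Tot E₂ => scale (‖y.snd‖ : 𝕜)⁻¹ y) h1)
  · by_cases hy : y = 0
    · simp [g, hy]
    · rw [map_smul, hLh, smul_inv_smul₀ (hn hy)]
  · by_cases hy : y = 0
    · simp [g, hy]
    by_cases hc : c = 0
    · simp [g, hc]
    have hc' : (‖c‖ : 𝕜) ≠ 0 := by simpa using hc
    -- Polar decomposition: the modulus of `c` is absorbed by the radial extension, its phase `u` by
    -- `hhom`.
    let u : S := ⟨(‖c‖ : 𝕜)⁻¹ * c, by simp [S, hc]⟩
    have h1 : (‖c • y‖ : 𝕜)⁻¹ • c • y = (u : 𝕜) • (‖y‖ : 𝕜)⁻¹ • y := by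
      simp only [u, norm_smul, smul_smul, RCLike.ofReal_mul, mul_inv]
      congr 1
      ring
    simp only [g]
    rw [h1, hhom, smul_smul, smul_smul]
    congr 1
    simp only [u, norm_smul, RCLike.ofReal_mul]
    field_simp

end Homogeneous

end BanachBundle

/-! ### Selecting from the fibers of the bundle map -/

theorem proposition3p12 {𝕜 : Type*} [RCLike 𝕜] {T : Type*} [TopologicalSpace T] [T2Space T]
    (E₁ : T → Type*) [∀ t, NormedAddCommGroup (E₁ t)] [∀ t, NormedSpace 𝕜 (E₁ t)]
    [TopologicalSpace (BanachBundle.Tot E₁)] [BanachBundle.IsBanachBundle 𝕜 E₁]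
    (E₂ : T → Type*) [∀ t, NormedAddCommGroup (E₂ t)] [∀ t, NormedSpace 𝕜 (E₂ t)]
    [TopologicalSpace (BanachBundle.Tot E₂)] [BanachBundle.IsBanachBundle 𝕜 E₂]
    [T2Space (BanachBundle.Tot E₂)] [ParacompactSpace (BanachBundle.Tot E₂)]
    (φ : BanachBundle.Tot E₁ → BanachBundle.Tot E₂) (hφ : BanachBundle.IsBundleMap 𝕜 φ)
    (hsurj : Function.Surjective φ) :
    (IsOpenMap φ →
      ∃ ψ : BanachBundle.Tot E₂ → BanachBundle.Tot E₁, Continuous ψ ∧ ∀ y, φ (ψ y) = y) ∧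
    (BanachBundle.HasContinuousNorm E₂ →
      (∃ m : ℝ, 0 < m ∧ ∀ y : BanachBundle.Tot E₂, ∃ x : BanachBundle.Tot E₁,
        φ x = y ∧ ‖x.snd‖ ≤ m * ‖y.snd‖) →
      ∃ ψ : BanachBundle.Tot E₂ → BanachBundle.Tot E₁, Continuous ψ ∧ (∀ y, φ (ψ y) = y) ∧
        ∀ (c : 𝕜) (y : BanachBundle.Tot E₂),
          ψ (BanachBundle.scale c y) = BanachBundle.scale c (ψ y)) := by
  let _ : ∀ t, NormedSpace ℝ (E₁ t) := fun t => NormedSpace.restrictScalars ℝ 𝕜 (E₁ t)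
  have _ : ∀ t, IsScalarTower ℝ 𝕜 (E₁ t) := fun t => RestrictScalars.isScalarTower ℝ 𝕜 (E₁ t)
  have _ : BanachBundle.IsBanachBundle ℝ E₁ := .restrictScalars 𝕜 E₁
  choose L₀ hL using hφ.linear_fiber
  have hq := BanachBundle.continuous_proj 𝕜 (E := E₂)
  have hLc : ∀ t, Continuous (L₀ t) := fun t => BanachBundle.continuous_fiber 𝕜 (by
    simp only [← hL]
    exact hφ.continuous.comp (BanachBundle.continuous_mk_fiber 𝕜 t))
  let L : ∀ t, E₁ t →L[𝕜] E₂ t := fun t => ⟨L₀ t, hLc t⟩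
  have hLφ : ∀ t x, φ ⟨t, x⟩ = ⟨t, L t x⟩ := hL
  have hconv : ∀ t (y : E₂ t), Convex ℝ {x | L t x = y} := fun t y x hx z hz a b _ _ hab => by
    have h1 : ∀ (r : ℝ) (x : E₁ t), r • x = (r : 𝕜) • x := fun _ _ => rfl
    rw [Set.mem_ofPred_eq] at hx hz ⊢
    rw [map_add, h1, h1, map_smul, map_smul, hx, hz, ← add_smul, ← RCLike.ofReal_add, hab,
      RCLike.ofReal_one, one_smul]
  have hclosed : ∀ t (y : E₂ t), IsClosed {x | L t x = y} := fun t y =>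
    isClosed_eq (L t).continuous continuous_const
  have hex : ∀ (t : T) (y : E₂ t) (P : BanachBundle.Tot E₁ → Prop),
      (∃ x, φ x = ⟨t, y⟩ ∧ P x) → ∃ x : E₁ t, L t x = y ∧ P ⟨t, x⟩ := by
    rintro t y P ⟨⟨s, x⟩, hx, hP⟩
    rw [hLφ] at hx
    obtain rfl : s = t := congrArg Bundle.TotalSpace.proj hx
    exact ⟨x, by simpa using hx, hP⟩
  have himage : ∀ W : Set (BanachBundle.Tot E₁),
      {y : BanachBundle.Tot E₂ | ∃ x ∈ {x | L y.proj x = y.snd},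
        (⟨y.proj, x⟩ : BanachBundle.Tot E₁) ∈ W} = φ '' W := by
    intro W
    ext y
    constructor
    · rintro ⟨x, hx, hxW⟩
      exact ⟨_, hxW, by rw [hLφ, hx]⟩
    · rintro ⟨x, hxW, rfl⟩
      exact hex _ _ (· ∈ W) ⟨x, rfl, hxW⟩
  refine ⟨fun hopen => ?_, fun hE₂ hm => ?_⟩
  · have hne : ∀ y : BanachBundle.Tot E₂, {x | L y.proj x = y.snd}.Nonempty := fun y => by
      obtain ⟨x, hx⟩ := hsurj y
      obtain ⟨x, hx, -⟩ := hex y.proj y.snd (fun _ => True) ⟨x, hx, trivial⟩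
      exact ⟨x, hx⟩
    obtain ⟨f, hf, hfC⟩ := BanachBundle.exists_continuous_selection hq
      (fun y => hconv _ _) hne fun W hW => by rw [himage]; exact hopen W hW
    refine ⟨_, hf, fun y => ?_⟩
    have := (hclosed _ _).closure_subset (hfC y)
    rw [hLφ, this]
  · obtain ⟨m, hm, hbd⟩ := hm
    have hbd' : ∀ t (y : E₂ t), ∃ x, L t x = y ∧ ‖x‖ ≤ m * ‖y‖ := fun t y =>
      hex t y (fun x => ‖x.snd‖ ≤ m * ‖y‖) (hbd ⟨t, y⟩)
    have hopen : IsOpenMap φ :=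
      BanachBundle.isOpenMap_of_bound hφ.continuous (fun t => (L t).toLinearMap) hLφ hm hbd'
    -- The `+ 1` keeps the open ball large enough to contain the given preimage, even for `y = 0`;
    -- on unit vectors the closure has bound `m + 1`.
    let C : ∀ y : BanachBundle.Tot E₂, Set (E₁ y.proj) := fun y =>
      {x | L y.proj x = y.snd} ∩ Metric.ball 0 (m * ‖y.snd‖ + 1)
    have hO : IsOpen {x : BanachBundle.Tot E₁ | ‖x.snd‖ < m * ‖(φ x).snd‖ + 1} := by
      refine isOpen_iff_eventually.2 fun x hx => ?_
      -- The norm of `E₁` is only upper semicontinuous, which controls the left side; the right side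
      -- is continuous because the norm of `E₂` is.
      obtain ⟨r, hr1, hr2⟩ := exists_between (show ‖x.snd‖ < m * ‖(φ x).snd‖ + 1 from hx)
      have hc : Continuous fun x => m * ‖(φ x).snd‖ + 1 :=
        (continuous_const.mul (hE₂.comp hφ.continuous)).add continuous_const
      filter_upwards [BanachBundle.IsBanachBundle.upperSemicontinuous_norm (𝕜 := 𝕜) (E := E₁)
        x r hr1, hc.continuousAt.eventually (lt_mem_nhds hr2)] with z h1 h2 using h1.trans h2
    have hlsc : ∀ W : Set (BanachBundle.Tot E₁), IsOpen W →
        IsOpen {y | ∃ x ∈ C y, (⟨y.proj, x⟩ : BanachBundle.Tot E₁) ∈ W} := by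
      intro W hW
      convert hopen _ (hW.inter hO) using 1
      rw [← himage]
      ext y
      refine exists_congr fun x => ⟨fun ⟨⟨h1, h2⟩, h3⟩ => ⟨h1, h3, ?_⟩,
        fun ⟨h1, h3, h2⟩ => ⟨⟨h1, ?_⟩, h3⟩⟩
      · rw [Set.mem_ofPred_eq, hLφ, h1]
        exact mem_ball_zero_iff.1 h2
      · rw [Set.mem_ofPred_eq, hLφ, h1] at h2
        exact mem_ball_zero_iff.2 h2
    obtain ⟨f, hf, hfC⟩ := BanachBundle.exists_continuous_selection hq
      (fun y => (hconv _ _).inter (convex_ball _ _)) (fun y => by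
        obtain ⟨x, hx, hxm⟩ := hbd' y.proj y.snd
        exact ⟨x, hx, mem_ball_zero_iff.2 (hxm.trans_lt (lt_add_one _))⟩) hlsc
    obtain ⟨g, hg, hLg, hgs⟩ := BanachBundle.exists_homogeneous_rightInverse hE₂ L
      (fun t y => f ⟨t, y⟩) hf
      (fun t y => (hclosed _ _).closure_subset (closure_mono Set.inter_subset_left (hfC ⟨t, y⟩)))
      (K := m + 1) fun t y hy => by
        have := Metric.closure_ball_subset_closedBall
          (closure_mono Set.inter_subset_right (hfC ⟨t, y⟩))
        simpa [hy] using this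
    refine ⟨_, hg, fun y => by rw [hLφ, hLg], fun c y => ?_⟩
    simp only [BanachBundle.scale, hgs]
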